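/- Fix an integer $d\ge 1$ and work on $\mathbb R^d$. Let $\mathcal F\varphi(k)=(2\pi)^{-d/2}\int_{\mathbb R^d}e^{-ik\cdot x}\varphi(x)\,dx$, let $\Phi$ be the Lizorkin space of complex Schwartz functions on $\mathbb R^d$ all of whose moments vanish, $\Phi'$ its dual (which contains the spaces $\mathbb L^p$ below via $\langle f,\phi\rangle=\int f\phi$), and for $s\ge 0$ let $D^s f:=\mathcal F^{-1}(|k|^s\mathcal F f)$ for $f\in\Phi'$, i.e. $\langle D^sf,\phi\rangle=\langle f,\mathcal F^{-1}(|k|^s\mathcal F\phi)\rangle$ for $\phi\in\Phi$. Let $\mathbb L^p:=L^p(\mathbb R^d,\mathbb C)$ for $1\le p<\infty$ and $\mathbb L^\infty:=C_0(\mathbb R^d,\mathbb C)$ (continuous functions vanishing at infinity, with the sup norm), and put $H^n:=\{f\in L^2: D^nf\in L^2\}$. Let $j,n,\theta$ be real numbers with $$0\le\theta\le1,\quad n,j\ge 0,\quad 0\le\theta n-j\le \tfrac d2,\quad \theta\ne1 \text{ if } n=j+\tfrac d2,$$ and let $r\in[2,+\infty]$ be defined by $\frac1r=\frac12-\frac{\theta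 n-j}{d}$. Let $G(j,n,\theta)$ be the sharp constant of the Gagliardo–Nirenberg inequality, that is, the infimum of the constants $C\in[0,+\infty)$ such that for all $f\in H^n$ one has $D^jf\in\mathbb L^r$ and $$\|D^jf\|_{\mathbb L^r}\le C\,\|f\|_{L^2}^{1-\theta}\,\|D^nf\|_{L^2}^{\theta}\qquad(0^0:=1)$$ (the infimum is $+\infty$ if there is no such constant). Let $J_\nu$ be the Bessel function of the first kind and $K_\nu$ the Macdonald function. Then $\lim_{s\to0^+}J_{d/2-1}(s)/s^{d/2-1}=1/(2^{d/2-1}\Gamma(d/2))$, and this limit is taken as the value of $J_{d/2-1}(s)/s^{d/2-1}$ at $s=0$. For $\varepsilon>0$ put $$U(j,n|\varepsilon):=\Big(\frac{2\pi^{d/2}}{\Gamma(d/2)}\int_0^{\infty}\frac{\xi^{2n-2j+d-1}K_{n-j}(\xi)^2}{(\xi^2+\varepsilon^2)^{2n-j}}\,d\xi\Big)^{1/2},\qquad V(j,n|\varepsilon):=\Big(\frac{2\pi^{d/2}}{\Gamma(d/2)}\int_0^{\infty}\frac{\xi^{4n-2j+d-1}K_{n-j}(\xi)^2}{(\xi^2+\varepsilon^2)^{2n-j}}\,d\xi\Big)^{1/2},$$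 $$M_{jn\varepsilon}(\rho):=\int_0^\infty \frac{J_{d/2-1}(\rho\xi)}{(\rho\xi)^{d/2-1}}\,\frac{\xi^{n+d-1}K_{n-j}(\xi)}{(\xi^2+\varepsilon^2)^{n-j/2}}\,d\xi\quad(\rho\ge0),$$ $$Y(j,n,\theta|\varepsilon):=\Big(\frac{2\pi^{d/2}}{\Gamma(d/2)}\int_0^\infty\rho^{d-1}|M_{jn\varepsilon}(\rho)|^r\,d\rho\Big)^{1/r}\ \text{ if } r<\infty,\qquad Y(j,n,\theta|\varepsilon):=\sup_{\rho\ge0}|M_{jn\varepsilon}(\rho)|\ \text{ if } r=\infty.$$ For every $\varepsilon>0$ all these integrals converge absolutely, the supremum (for $r=\infty$) is finite, $M_{jn\varepsilon}$ is continuous on $[0,+\infty)$, and $U(j,n|\varepsilon),V(j,n|\varepsilon)>0$. With $$G_-(j,n,\theta|\varepsilon):=\frac{Y(j,n,\theta|\varepsilon)}{U(j,n|\varepsilon)^{1-\theta}\,V(j,n|\varepsilon)^{\theta}},$$ one has $G(j,n,\theta)\ge G_-(j,n,\theta|\varepsilon)$ for every $\varepsilon>0$, and hence $G(j,n,\theta)\ge\sup_{\varepsilon>0}G_-(j,n,\theta|\varepsilon)$.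 -/

import Mathlib

open MeasureTheory Set Filter Topology
open scoped ENNReal NNReal

namespace GagliardoNirenberg

noncomputable section

/-- The Euclidean space `ℝ^d`. -/
abbrev E (d : ℕ) : Type := EuclideanSpace ℝ (Fin d)

/-! ### Fractional Laplacian -/

/-- The Fourier transform in the unitary normalization
`(2π)^(-d/2) ∫ e^(-i k·x) φ(x) dx`. -/
def fourierT {d : ℕ} (φ : E d → ℂ) (k : E d) : ℂ :=
  (((2 * Real.pi) ^ (-(d : ℝ) / 2) : ℝ) : ℂ) *
    ∫ x : E d, Complex.exp (-(Complex.I * ((inner ℝ k x : ℝ) : ℂ))) * φ x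

/-- Membership in the Lizorkin space `Φ`: Schwartz functions all of whose moments vanish. -/
def IsLizorkin {d : ℕ} (φ : SchwartzMap (E d) ℂ) : Prop :=
  ∀ (m : ℕ) (i : Fin m → Fin d), ∫ x : E d, ((∏ l, x (i l) : ℝ) : ℂ) * φ x = 0

/-- For functions `f`, `g` on `ℝ^d` (viewed as elements of the dual `Φ'` of the Lizorkin space, by
integration against test functions) the relation `D^s f = g`, where `D = (-Δ)^(1/2)`. The operator
`D^s f = F⁻¹(|k|^s F f)` on `Φ'` is the transpose of the operator `φ ↦ χ = F⁻¹(|k|^s F φ)` of `Φ`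
into itself, so `D^s f = g` means `⟨g, φ⟩ = ⟨f, χ⟩` for all test functions `φ`. -/
def IsFracLaplacian {d : ℕ} (s : ℝ) (f g : E d → ℂ) : Prop :=
  ∀ φ χ : SchwartzMap (E d) ℂ, IsLizorkin φ → IsLizorkin χ →
    (∀ k : E d, fourierT χ k = ((‖k‖ ^ s : ℝ) : ℂ) * fourierT φ k) →
    ∫ x : E d, g x * φ x = ∫ x : E d, f x * χ x

/-- Membership in `𝕃^p`: the usual `L^p` for `p < ∞`, and the continuous functions vanishing at
infinity for `p = ∞`. In all cases the norm is the usual `L^p` norm `eLpNorm`. -/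
def MemLL {d : ℕ} (p : ℝ≥0∞) (f : E d → ℂ) : Prop :=
  if p = ⊤ then Continuous f ∧ Tendsto f (cocompact (E d)) (𝓝 0) else MemLp f p volume

/-! ### The Gagliardo-Nirenberg inequality -/

/-- The conditions on `j`, `n`, `θ` in the general `L²` case. -/
def GeneralL2 (d : ℕ) (j n θ : ℝ) : Prop :=
  0 ≤ θ ∧ θ ≤ 1 ∧ 0 ≤ n ∧ 0 ≤ j ∧ 0 ≤ θ * n - j ∧ θ * n - j ≤ (d : ℝ) / 2 ∧
    (n = j + (d : ℝ) / 2 → θ ≠ 1)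

/-- The exponent `r ∈ [2, ∞]` with `1/r = 1/2 - (θ n - j)/d`
(it is `∞` when the right-hand side is `0`). -/
def rExp (d : ℕ) (j n θ : ℝ) : ℝ≥0∞ :=
  (ENNReal.ofReal (1 / 2 - (θ * n - j) / (d : ℝ)))⁻¹

/-- The Gagliardo-Nirenberg inequality holds with the constant `C`: for every `f` in
`H^n = {f ∈ L² | D^n f ∈ L²}` (here `u = D^n f`) one has `D^j f ∈ 𝕃^r` and
`‖D^j f‖_r ≤ C ‖f‖₂^(1-θ) ‖D^n f‖₂^θ`. -/
def GNHolds (d : ℕ) (j n θ : ℝ) (C : ℝ≥0) : Prop :=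
  ∀ f u : E d → ℂ, MemLp f 2 volume → MemLp u 2 volume → IsFracLaplacian n f u →
    (∃ v : E d → ℂ, MemLL (rExp d j n θ) v ∧ IsFracLaplacian j f v) ∧
    ∀ v : E d → ℂ, MemLL (rExp d j n θ) v → IsFracLaplacian j f v →
      eLpNorm v (rExp d j n θ) volume ≤
        (C : ℝ≥0∞) * eLpNorm f 2 volume ^ (1 - θ) * eLpNorm u 2 volume ^ θ

/-- The sharp constant `G(j,n,θ)`: the infimum of the constants `C ∈ [0,∞)` for which the
Gagliardo-Nirenberg inequality holds. -/
def sharpG (d : ℕ) (j n θ : ℝ) : ℝ≥0∞ :=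
  ⨅ C ∈ {C : ℝ≥0 | GNHolds d j n θ C}, (C : ℝ≥0∞)

/-! ### Bessel functions -/

/-- The Bessel function of the first kind `J_ν(s)`, `s > 0`. (The value `0` of `Real.Gamma` at its
poles makes the corresponding terms zero, as it should be.) -/
def besselJ (ν s : ℝ) : ℝ :=
  ∑' m : ℕ, (-1 : ℝ) ^ m / ((m.factorial : ℝ) * Real.Gamma ((m : ℝ) + ν + 1)) *
    (s / 2) ^ (2 * (m : ℝ) + ν)

/-- The Macdonald function (modified Bessel function of the second kind)
`K_ν(s) = ∫_0^∞ e^(-s cosh t) cosh(ν t) dt`, `s > 0`. -/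
def macdonaldK (ν s : ℝ) : ℝ :=
  ∫ t in Ioi (0 : ℝ), Real.exp (-(s * Real.cosh t)) * Real.cosh (ν * t)

/-- `J_{d/2-1}(s) / s^(d/2-1)` for `s > 0`, with the value `1 / (2^(d/2-1) Γ(d/2))` at `s = 0`. -/
def radialKernel (d : ℕ) (s : ℝ) : ℝ :=
  if s = 0 then 1 / ((2 : ℝ) ^ ((d : ℝ) / 2 - 1) * Real.Gamma ((d : ℝ) / 2))
  else besselJ ((d : ℝ) / 2 - 1) s / s ^ ((d : ℝ) / 2 - 1)

/-! ### The lower bound -/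

/-- The area `2 π^(d/2) / Γ(d/2)` of the unit sphere of `ℝ^d`. -/
def sphereArea (d : ℕ) : ℝ := 2 * Real.pi ^ ((d : ℝ) / 2) / Real.Gamma ((d : ℝ) / 2)

def integrandU (d : ℕ) (j n ε ξ : ℝ) : ℝ :=
  ξ ^ (2 * n - 2 * j + (d : ℝ) - 1) * macdonaldK (n - j) ξ ^ 2 / (ξ ^ 2 + ε ^ 2) ^ (2 * n - j)

def integrandV (d : ℕ) (j n ε ξ : ℝ) : ℝ :=
  ξ ^ (4 * n - 2 * j + (d : ℝ) - 1) * macdonaldK (n - j) ξ ^ 2 / (ξ ^ 2 + ε ^ 2) ^ (2 * n - j)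

def integrandM (d : ℕ) (j n ε ρ ξ : ℝ) : ℝ :=
  radialKernel d (ρ * ξ) *
    (ξ ^ (n + (d : ℝ) - 1) * macdonaldK (n - j) ξ / (ξ ^ 2 + ε ^ 2) ^ (n - j / 2))

def U (d : ℕ) (j n ε : ℝ) : ℝ :=
  (sphereArea d * ∫ ξ in Ioi (0 : ℝ), integrandU d j n ε ξ) ^ ((1 : ℝ) / 2)

def V (d : ℕ) (j n ε : ℝ) : ℝ :=
  (sphereArea d * ∫ ξ in Ioi (0 : ℝ), integrandV d j n ε ξ) ^ ((1 : ℝ) / 2)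

def M (d : ℕ) (j n ε ρ : ℝ) : ℝ := ∫ ξ in Ioi (0 : ℝ), integrandM d j n ε ρ ξ

def integrandY (d : ℕ) (j n θ ε ρ : ℝ) : ℝ :=
  ρ ^ ((d : ℝ) - 1) * |M d j n ε ρ| ^ (rExp d j n θ).toReal

/-- `Y(j,n,θ|ε)`; for `r = ∞` the `L^r` norm is the supremum. -/
def Y (d : ℕ) (j n θ ε : ℝ) : ℝ :=
  if rExp d j n θ = ⊤ then sSup ((fun ρ => |M d j n ε ρ|) '' Ici 0)
  else (sphereArea d * ∫ ρ in Ioi (0 : ℝ), integrandY d j n θ ε ρ) ^ (1 / (rExp d j n θ).toReal)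

/-- `G_-(j,n,θ|ε)`. -/
def Gminus (d : ℕ) (j n θ ε : ℝ) : ℝ :=
  Y d j n θ ε / (U d j n ε ^ (1 - θ) * V d j n ε ^ θ)

end

end GagliardoNirenberg

/-! Any nonzero `f` in `H^n` bounds the sharp constant from below by the ratio `‖D^j f‖_r /
(‖f‖₂^(1-θ) ‖D^n f‖₂^θ)`, and `G_-` is this ratio for one explicit radial family. In frequency space
take the profile `ξ^a K_(n-j)(ξ) / (ξ² + ε²)^(n-j/2)` with `a = n - j`, and let `f` be its Fourier
transform (for a radial function the direct and inverse transforms agree). Then `D^s` multiplies the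
profile by `ξ^s`, so `f`, `D^j f` and `D^n f` have exponents `a = n - j`, `n` and `2n - j`.

Plancherel (`fourierT_memLp_two_and_eLpNorm_eq`) and polar coordinates turn `‖f‖₂` and `‖D^n f‖₂`
into `U` and `V`. The radial Fourier formula (`fourierT_radial`) shows that `D^j f` is `k ↦ M(‖k‖)`,
so its `L^r` norm is `Y` (at `r = ∞` only `Y ≤ ‖D^j f‖_∞` is needed). The relation `D^s f = g`
against Lizorkin test functions follows from the multiplication formula
(`isFracLaplacian_fourierT`).

Two analytic inputs remain. The Bessel kernel is the Fourier transform of the surface measure of the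
sphere, found by expanding the exponential and computing the moments of the sphere from Gaussian
integrals; this gives its continuity, its boundedness and its value at `0`. A crude bound on `K_ν`
makes every profile integrable and square integrable. -/

namespace GagliardoNirenberg

/-! ### Polar coordinates and the moments of the unit sphere -/

open Metric in
/-- Integration in polar coordinates. -/
theorem integral_polar {d : ℕ} (hd : 1 ≤ d) {F : Type*} [NormedAddCommGroup F] [NormedSpace ℝ F]
    {f : E d → F} (hf : Integrable f) :
    ∫ x, f x = ∫ r in Ioi (0 : ℝ), r ^ (d - 1) •
      ∫ ω : sphere (0 : E d) 1, f (r • (ω : E d)) ∂(volume : Measure (E d)).toSphere := by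
  have : Nonempty (Fin d) := ⟨⟨0, hd⟩⟩
  set μ : Measure (E d) := volume
  have hdim : Module.finrank ℝ (E d) = d := by simp
  have hmp := μ.measurePreserving_homeomorphUnitSphereProd
  have hemb := (homeomorphUnitSphereProd (E d)).measurableEmbedding
  set g : sphere (0 : E d) 1 × Ioi (0 : ℝ) → F := fun p => f (p.2.1 • p.1.1) with hg
  have hcomp : (g ∘ homeomorphUnitSphereProd (E d)) = fun x : ({0}ᶜ : Set (E d)) => f x := by
    funext x
    have h := congrArg Subtype.val ((homeomorphUnitSphereProd (E d)).symm_apply_apply x)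
    rw [homeomorphUnitSphereProd_symm_apply_coe] at h
    simp only [hg, Function.comp_apply, h]
  have hint : Integrable g (μ.toSphere.prod (.volumeIoiPow (Module.finrank ℝ (E d) - 1))) := by
    rw [← hmp.integrable_comp_emb hemb, hcomp]
    exact (integrableOn_iff_comap_subtypeVal (measurableSet_singleton _).compl).1 hf.integrableOn
  calc
    ∫ x, f x ∂μ = ∫ x : ({(0)}ᶜ : Set (E d)), f x.1 ∂(μ.comap (↑)) := by
      rw [integral_subtype_comap (measurableSet_singleton _).compl f,
        restrict_compl_singleton]
    _ = ∫ x, g x ∂μ.toSphere.prod (.volumeIoiPow (Module.finrank ℝ (E d) - 1)) := by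
      rw [← hmp.integral_comp hemb]
      exact congrArg (fun h => ∫ x, h x ∂(μ.comap _)) hcomp.symm
    _ = ∫ r : Ioi (0 : ℝ), (∫ ω, g (ω, r) ∂μ.toSphere)
          ∂.volumeIoiPow (Module.finrank ℝ (E d) - 1) := integral_prod_symm _ hint
    _ = _ := by
      simp only [Measure.volumeIoiPow, ENNReal.ofReal, hdim]
      rw [integral_withDensity_eq_integral_smul,
        integral_subtype_comap measurableSet_Ioi fun a ↦ Real.toNNReal (a ^ (d - 1)) •
          ∫ ω : sphere (0 : E d) 1, f (a • (ω : E d)) ∂μ.toSphere,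
        setIntegral_congr_fun measurableSet_Ioi fun x hx ↦ ?_]
      · rw [NNReal.smul_def, Real.coe_toNNReal _ (pow_nonneg hx.out.le _)]
      · exact (measurable_subtype_coe.pow_const _).real_toNNReal

/-- A unit vector is an element of some orthonormal basis. -/
theorem exists_orthonormalBasis_apply_eq {d : ℕ} (i₀ : Fin d) {e : E d} (he : ‖e‖ = 1) :
    ∃ b : OrthonormalBasis (Fin d) ℝ (E d), b i₀ = e := by
  obtain ⟨b, hb⟩ := Orthonormal.exists_orthonormalBasis_extension_of_card_eq (𝕜 := ℝ)
    (E := E d) (ι := Fin d) (by simp) (v := fun _ => e) (s := {i₀})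
    ⟨fun i => by simpa using he, fun i k hik => (hik (Subsingleton.elim i k)).elim⟩
  exact ⟨b, hb i₀ rfl⟩

theorem integrable_pow_mul_exp_neg_sq (k : ℕ) :
    Integrable fun t : ℝ => t ^ k * Real.exp (-t ^ 2) := by
  simpa using integrable_rpow_mul_exp_neg_mul_sq (b := 1) one_pos (s := (k : ℝ))
    (by have := k.cast_nonneg (α := ℝ); linarith)

/-- In an orthonormal basis containing `e` the integrand is a product of functions of one coordinate
each, so Fubini applies. -/
theorem gaussian_moment {d : ℕ} (hd : 1 ≤ d) {e : E d} (he : ‖e‖ = 1) (k : ℕ) :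
    Integrable (fun x : E d => inner ℝ x e ^ k * Real.exp (-‖x‖ ^ 2)) ∧
    ∫ x : E d, inner ℝ x e ^ k * Real.exp (-‖x‖ ^ 2) =
      (∫ t : ℝ, t ^ k * Real.exp (-t ^ 2)) * √Real.pi ^ (d - 1) := by
  let i₀ : Fin d := ⟨0, hd⟩
  obtain ⟨b, hb⟩ := exists_orthonormalBasis_apply_eq i₀ he
  let φ : Fin d → ℝ → ℝ := fun i t => (if i = i₀ then t ^ k else 1) * Real.exp (-t ^ 2)
  have hφ : ∀ i, Integrable (φ i) := fun i => by
    by_cases h : i = i₀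
    · simpa [φ, h] using integrable_pow_mul_exp_neg_sq k
    · simpa [φ, h] using integrable_pow_mul_exp_neg_sq 0
  have hmp := (EuclideanSpace.volume_preserving_symm_measurableEquiv_toLp (Fin d)).comp
    b.measurePreserving_repr
  have hemb : MeasurableEmbedding ((MeasurableEquiv.toLp 2 (Fin d → ℝ)).symm ∘ b.repr) :=
    (MeasurableEquiv.measurableEmbedding _).comp b.repr.toHomeomorph.measurableEmbedding
  have hfun : (fun x : E d => inner ℝ x e ^ k * Real.exp (-‖x‖ ^ 2)) =
      (fun y : Fin d → ℝ => ∏ i, φ i (y i)) ∘ ((MeasurableEquiv.toLp 2 (Fin d → ℝ)).symm ∘ b.repr) := by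
    funext x
    have h1 : ‖x‖ ^ 2 = ∑ i, b.repr x i ^ 2 := by
      rw [← b.repr.norm_map x, EuclideanSpace.norm_sq_eq]
      simp
    have h2 : inner ℝ x e = b.repr x i₀ := by
      rw [b.repr_apply_apply, hb, real_inner_comm]
    simp only [Function.comp_apply, φ, Finset.prod_mul_distrib, h1, h2, ← Finset.sum_neg_distrib,
      Real.exp_sum]
    simp
  rw [hfun]
  refine ⟨(hmp.integrable_comp_emb hemb).2 (Integrable.fintype_prod hφ), ?_⟩
  have h1 : ∫ x, ((fun y : Fin d → ℝ => ∏ i, φ i (y i)) ∘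
      ((MeasurableEquiv.toLp 2 (Fin d → ℝ)).symm ∘ b.repr)) x = ∏ i, ∫ t, φ i t := by
    rw [← integral_fintype_prod_volume_eq_prod (𝕜 := ℝ) φ]
    exact hmp.integral_comp hemb (fun y : Fin d → ℝ => ∏ i, φ i (y i))
  have h2 : ∀ i ∈ Finset.univ.erase i₀, ∫ t, φ i t = √Real.pi := fun i hi => by
    have := integral_gaussian 1
    simp_all [φ]
  rw [h1, ← Finset.mul_prod_erase _ _ (Finset.mem_univ i₀), Finset.prod_congr rfl h2]
  simp [φ]

theorem integral_pow_mul_exp_neg_sq_odd (m : ℕ) :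
    ∫ t : ℝ, t ^ (2 * m + 1) * Real.exp (-t ^ 2) = 0 := by
  have h := integral_neg_eq_self (fun t : ℝ => t ^ (2 * m + 1) * Real.exp (-t ^ 2)) volume
  have h2 : (fun t : ℝ => (-t) ^ (2 * m + 1) * Real.exp (-(-t) ^ 2)) =
      fun t => -(t ^ (2 * m + 1) * Real.exp (-t ^ 2)) := by
    funext t
    rw [Odd.neg_pow ⟨m, rfl⟩, neg_sq, neg_mul]
  simp only [h2, integral_neg] at h
  linarith

theorem integral_Ioi_pow_mul_exp_neg_sq (k : ℕ) :
    ∫ t in Ioi (0 : ℝ), t ^ k * Real.exp (-t ^ 2) = 1 / 2 * Real.Gamma (((k : ℝ) + 1) / 2) := by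
  rw [← integral_rpow_mul_exp_neg_rpow (p := 2) (q := k) two_pos
    (by have := k.cast_nonneg (α := ℝ); linarith)]
  simp

theorem integral_pow_mul_exp_neg_sq_even (m : ℕ) :
    ∫ t : ℝ, t ^ (2 * m) * Real.exp (-t ^ 2) = Real.Gamma ((m : ℝ) + 1 / 2) := by
  have h := integral_comp_abs (f := fun t : ℝ => t ^ (2 * m) * Real.exp (-t ^ 2))
  simp only [sq_abs, pow_mul] at h
  simp only [pow_mul, h]
  have := integral_Ioi_pow_mul_exp_neg_sq (2 * m)
  simp only [pow_mul] at this
  rw [this]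
  push_cast
  ring_nf

-- In polar coordinates the Gaussian moment along `e` splits into a radial Gamma integral times the
-- moment of the sphere; equating this with the Cartesian value determines the latter.
open Metric in
theorem sphere_moment_mul_Gamma {d : ℕ} (hd : 1 ≤ d) {e : E d} (he : ‖e‖ = 1) (k : ℕ) :
    (1 / 2 * Real.Gamma (((d : ℝ) + k) / 2)) *
      ∫ ω : sphere (0 : E d) 1, inner ℝ (ω : E d) e ^ k ∂(volume : Measure (E d)).toSphere =
      (∫ t : ℝ, t ^ k * Real.exp (-t ^ 2)) * √Real.pi ^ (d - 1) := by
  obtain ⟨h1, h2⟩ := gaussian_moment hd he k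
  rw [← h2, integral_polar hd h1]
  have h3 : ∀ r ∈ Ioi (0 : ℝ), r ^ (d - 1) • ∫ ω : sphere (0 : E d) 1,
      inner ℝ (r • (ω : E d)) e ^ k * Real.exp (-‖r • (ω : E d)‖ ^ 2)
        ∂(volume : Measure (E d)).toSphere =
      (r ^ (d - 1 + k) * Real.exp (-r ^ 2)) *
        ∫ ω : sphere (0 : E d) 1, inner ℝ (ω : E d) e ^ k ∂(volume : Measure (E d)).toSphere := by
    intro r hr
    have : ∀ ω : sphere (0 : E d) 1,
        inner ℝ (r • (ω : E d)) e ^ k * Real.exp (-‖r • (ω : E d)‖ ^ 2) =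
        r ^ k * Real.exp (-r ^ 2) * inner ℝ (ω : E d) e ^ k := fun ω => by
      rw [norm_smul, norm_eq_of_mem_sphere, mul_one, Real.norm_eq_abs, sq_abs, real_inner_smul_left,
        mul_pow]
      ring
    simp only [this, integral_const_mul, smul_eq_mul]
    ring
  rw [setIntegral_congr_fun measurableSet_Ioi h3, integral_mul_const,
    integral_Ioi_pow_mul_exp_neg_sq]
  congr 4
  rw [Nat.cast_add, Nat.cast_sub hd]
  push_cast
  ring

theorem Gamma_add_div_two_pos {d : ℕ} (hd : 1 ≤ d) (k : ℕ) :
    0 < Real.Gamma (((d : ℝ) + k) / 2) := by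
  have : (1 : ℝ) ≤ d := by exact_mod_cast hd
  exact Real.Gamma_pos_of_pos (by positivity)

open Metric in
theorem sphere_moment_odd {d : ℕ} (hd : 1 ≤ d) {e : E d} (he : ‖e‖ = 1) (m : ℕ) :
    ∫ ω : sphere (0 : E d) 1, inner ℝ (ω : E d) e ^ (2 * m + 1)
      ∂(volume : Measure (E d)).toSphere = 0 := by
  have h := sphere_moment_mul_Gamma hd he (2 * m + 1)
  have h2 := Gamma_add_div_two_pos hd (2 * m + 1)
  rw [integral_pow_mul_exp_neg_sq_odd, zero_mul] at h
  exact (mul_eq_zero.1 h).resolve_left (by positivity)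

theorem Gamma_nat_add_half_eq_factorial (m : ℕ) :
    Real.Gamma ((m : ℝ) + 1 / 2) =
      ((2 * m).factorial : ℝ) * √Real.pi / (4 ^ m * (m.factorial : ℝ)) := by
  induction m with
  | zero => simpa using Real.Gamma_one_half_eq
  | succ m ih =>
    have h0 : (0 : ℝ) < m.factorial := by exact_mod_cast m.factorial_pos
    rw [show ((m + 1 : ℕ) : ℝ) + 1 / 2 = (m + 1 / 2 : ℝ) + 1 by push_cast; ring,
      Real.Gamma_add_one (by positivity), ih, show 2 * (m + 1) = 2 * m + 1 + 1 by ring,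
      Nat.factorial_succ, Nat.factorial_succ, Nat.factorial_succ]
    push_cast
    field_simp
    ring

open Metric in
theorem sphere_moment_even {d : ℕ} (hd : 1 ≤ d) {e : E d} (he : ‖e‖ = 1) (m : ℕ) :
    ∫ ω : sphere (0 : E d) 1, inner ℝ (ω : E d) e ^ (2 * m)
      ∂(volume : Measure (E d)).toSphere =
      2 * ((2 * m).factorial : ℝ) * Real.pi ^ ((d : ℝ) / 2) /
        (4 ^ m * (m.factorial : ℝ) * Real.Gamma ((m : ℝ) + (d : ℝ) / 2)) := by
  have h := sphere_moment_mul_Gamma hd he (2 * m)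
  have h2 := Gamma_add_div_two_pos hd (2 * m)
  have h3 : ((d : ℝ) + (2 * m : ℕ)) / 2 = m + (d : ℝ) / 2 := by push_cast; ring
  have h4 : Real.pi ^ ((d : ℝ) / 2) = √Real.pi * √Real.pi ^ (d - 1) := by
    rw [← pow_succ', Nat.sub_add_cancel hd, Real.sqrt_eq_rpow, ← Real.rpow_natCast,
      ← Real.rpow_mul Real.pi_pos.le]
    ring_nf
  rw [h3] at h h2
  rw [integral_pow_mul_exp_neg_sq_even, Gamma_nat_add_half_eq_factorial] at h
  have h0 : (0 : ℝ) < m.factorial := by exact_mod_cast m.factorial_pos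
  rw [h4]
  field_simp at h ⊢
  linarith

/-! ### The Bessel kernel as the Fourier transform of the sphere -/

open Metric in
/-- The Fourier transform of the surface measure of the unit sphere. -/
theorem hasSum_sphere_exp {d : ℕ} (hd : 1 ≤ d) {e : E d} (he : ‖e‖ = 1) (s : ℝ) :
    HasSum (fun m : ℕ => ((2 * Real.pi ^ ((d : ℝ) / 2) * ((-1 : ℝ) ^ m /
        ((m.factorial : ℝ) * Real.Gamma ((m : ℝ) + (d : ℝ) / 2)) * (s / 2) ^ (2 * m)) : ℝ) : ℂ))
      (∫ ω : sphere (0 : E d) 1, Complex.exp (-(Complex.I * ((s * inner ℝ (ω : E d) e : ℝ) : ℂ)))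
        ∂(volume : Measure (E d)).toSphere) := by
  set σ := (volume : Measure (E d)).toSphere
  have hle : ∀ ω : sphere (0 : E d) 1, |inner ℝ (ω : E d) e| ≤ 1 := fun ω => by
    have := abs_real_inner_le_norm (ω : E d) e
    rwa [norm_eq_of_mem_sphere, he, one_mul] at this
  have key : HasSum (fun k : ℕ => ∫ ω : sphere (0 : E d) 1,
      (-(Complex.I * ((s * inner ℝ (ω : E d) e : ℝ) : ℂ))) ^ k / (k.factorial : ℂ) ∂σ)
      (∫ ω : sphere (0 : E d) 1, Complex.exp (-(Complex.I * ((s * inner ℝ (ω : E d) e : ℝ) : ℂ)))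
        ∂σ) := by
    refine hasSum_integral_of_dominated_convergence (fun k _ => |s| ^ k / (k.factorial : ℝ))
      (fun k => ?_) (fun k => ?_) ?_ ?_ ?_
    · exact Continuous.aestronglyMeasurable (by fun_prop)
    · refine .of_forall fun ω => ?_
      simp only [norm_div, norm_pow, norm_neg, norm_mul, Complex.norm_I, one_mul,
        Complex.norm_real, Complex.norm_natCast, Real.norm_eq_abs]
      gcongr
      exact mul_le_of_le_one_right (abs_nonneg _) (hle ω)
    · exact .of_forall fun _ => Real.summable_pow_div_factorial _
    · exact integrable_const _
    · refine .of_forall fun ω => ?_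
      rw [Complex.exp_eq_exp_ℂ]
      exact NormedSpace.expSeries_div_hasSum_exp _
  have hterm : ∀ k : ℕ, ∫ ω : sphere (0 : E d) 1,
      (-(Complex.I * ((s * inner ℝ (ω : E d) e : ℝ) : ℂ))) ^ k / (k.factorial : ℂ) ∂σ =
      (-(Complex.I * s)) ^ k / (k.factorial : ℂ) *
        ((∫ ω : sphere (0 : E d) 1, inner ℝ (ω : E d) e ^ k ∂σ : ℝ) : ℂ) := fun k => by
    rw [← integral_complex_ofReal, ← integral_const_mul]
    congr 1
    funext ω
    push_cast
    ring
  simp only [hterm] at key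
  -- Odd moments vanish, so the exponential series is reindexed over even `k = 2 * m`.
  have hinj : Function.Injective fun m : ℕ => 2 * m := fun a b h => by simpa using h
  rw [← hinj.hasSum_iff] at key
  · convert key using 1
    funext m
    have h0 : (m.factorial : ℂ) ≠ 0 := by exact_mod_cast m.factorial_ne_zero
    have h1 : ((2 * m).factorial : ℂ) ≠ 0 := by exact_mod_cast (2 * m).factorial_ne_zero
    simp only [Function.comp_apply, σ]
    rw [sphere_moment_even hd he]
    have h2 : (-(Complex.I * (s : ℂ))) ^ (2 * m) = (-1) ^ m * (s : ℂ) ^ (2 * m) := by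
      rw [pow_mul, neg_sq, mul_pow, Complex.I_sq, mul_pow, ← pow_mul]
    have h3 : (4 : ℂ) ^ m = 2 ^ (2 * m) := by rw [pow_mul]; norm_num
    rw [h2]
    push_cast
    rw [h3, div_pow]
    field_simp
  · intro k hk
    obtain ⟨m, rfl | rfl⟩ := k.even_or_odd'
    · exact (hk ⟨m, rfl⟩).elim
    · simp [σ, sphere_moment_odd hd he m]

open Metric in
/-- The radial kernel is the normalized Fourier transform of the surface measure. -/
theorem sphere_exp_eq_radialKernel {d : ℕ} (hd : 1 ≤ d) {e : E d} (he : ‖e‖ = 1) {s : ℝ}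
    (hs : 0 ≤ s) :
    (((2 * Real.pi) ^ (-(d : ℝ) / 2) : ℝ) : ℂ) *
      ∫ ω : sphere (0 : E d) 1, Complex.exp (-(Complex.I * ((s * inner ℝ (ω : E d) e : ℝ) : ℂ)))
        ∂(volume : Measure (E d)).toSphere = (radialKernel d s : ℂ) := by
  have h := hasSum_sphere_exp hd he s
  have hc : (2 * Real.pi) ^ (-(d : ℝ) / 2) * (2 * Real.pi ^ ((d : ℝ) / 2)) =
      (2 ^ ((d : ℝ) / 2 - 1))⁻¹ := by
    rw [neg_div, Real.rpow_neg (by positivity), Real.mul_rpow (by positivity) (by positivity),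
      Real.rpow_sub_one (by positivity)]
    have : (0 : ℝ) < Real.pi ^ ((d : ℝ) / 2) := by positivity
    field_simp
  rw [← h.tsum_eq, ← Complex.ofReal_tsum, ← Complex.ofReal_mul, tsum_mul_left, ← mul_assoc, hc]
  congr 1
  unfold radialKernel
  split_ifs with h0
  · subst h0
    rw [tsum_eq_single 0 (fun m hm => by simp [hm])]
    simp [mul_comm]
  · have hs' : 0 < s := lt_of_le_of_ne hs (Ne.symm h0)
    rw [besselJ, ← tsum_mul_left, ← tsum_div_const]
    congr 1
    funext m
    rw [Real.rpow_add (by positivity), Real.div_rpow hs (by positivity) ((d : ℝ) / 2 - 1),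
      show (m : ℝ) + ((d : ℝ) / 2 - 1) + 1 = m + (d : ℝ) / 2 by ring]
    have h1 : (s / 2) ^ (2 * (m : ℝ)) = (s / 2) ^ (2 * m) := by
      rw [← Real.rpow_natCast]; push_cast; rfl
    have h2 : (0 : ℝ) < s ^ ((d : ℝ) / 2 - 1) := by positivity
    rw [h1]
    field_simp

open scoped FourierTransform

-- The sphere integral `κ` makes sense for every real `s` and has an integrand of modulus one,
-- whence continuity by dominated convergence and a bound by the total mass. Only `s ≥ 0` matters
-- for `radialKernel`, which is built from real powers of `s`.
open Metric in
theorem exists_radialKernel_repr {d : ℕ} (hd : 1 ≤ d) :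
    ∃ κ : ℝ → ℂ, Continuous κ ∧ (∃ B, ∀ s, ‖κ s‖ ≤ B) ∧
      ∀ s, 0 ≤ s → κ s = (radialKernel d s : ℂ) := by
  have he : ‖(EuclideanSpace.single ⟨0, hd⟩ 1 : E d)‖ = 1 := by simp
  set e : E d := EuclideanSpace.single ⟨0, hd⟩ 1
  set σ := (volume : Measure (E d)).toSphere
  have hnorm : ∀ (s : ℝ) (ω : sphere (0 : E d) 1),
      ‖Complex.exp (-(Complex.I * ((s * inner ℝ (ω : E d) e : ℝ) : ℂ)))‖ = 1 := fun s ω => by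
    rw [← mul_neg, ← Complex.ofReal_neg, mul_comm, Complex.norm_exp_ofReal_mul_I]
  refine ⟨fun s => (((2 * Real.pi) ^ (-(d : ℝ) / 2) : ℝ) : ℂ) *
      ∫ ω : sphere (0 : E d) 1, Complex.exp (-(Complex.I * ((s * inner ℝ (ω : E d) e : ℝ) : ℂ)))
        ∂σ, ?_, ⟨(2 * Real.pi) ^ (-(d : ℝ) / 2) * σ.real univ, fun s => ?_⟩,
      fun s hs => sphere_exp_eq_radialKernel hd he hs⟩
  · refine continuous_const.mul (continuous_of_dominated (bound := fun _ => 1) (fun s => ?_)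
      (fun s => ?_) (integrable_const _) ?_)
    · exact Continuous.aestronglyMeasurable (by fun_prop)
    · exact .of_forall fun ω => (hnorm s ω).le
    · exact .of_forall fun ω => by fun_prop
  · rw [norm_mul, Complex.norm_real, Real.norm_eq_abs, abs_of_nonneg (by positivity)]
    gcongr
    refine (norm_integral_le_integral_norm _).trans ?_
    simp only [hnorm]
    simp

theorem continuousOn_radialKernel {d : ℕ} (hd : 1 ≤ d) :
    ContinuousOn (radialKernel d) (Ici 0) := by
  obtain ⟨κ, hκ, -, h⟩ := exists_radialKernel_repr hd
  exact (Complex.continuous_re.comp hκ).continuousOn.congr fun s hs => by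
    simp [h s hs]

theorem exists_abs_radialKernel_le {d : ℕ} (hd : 1 ≤ d) :
    ∃ B, ∀ s, 0 ≤ s → |radialKernel d s| ≤ B := by
  obtain ⟨κ, -, ⟨B, hB⟩, h⟩ := exists_radialKernel_repr hd
  refine ⟨B, fun s hs => ?_⟩
  have := hB s
  rwa [h s hs, Complex.norm_real, Real.norm_eq_abs] at this

/-- The limit at `0` of the Bessel quotient. -/
theorem tendsto_besselJ_div_rpow {d : ℕ} (hd : 1 ≤ d) :
    Tendsto (fun s : ℝ => besselJ ((d : ℝ) / 2 - 1) s / s ^ ((d : ℝ) / 2 - 1)) (𝓝[>] 0)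
      (𝓝 (1 / ((2 : ℝ) ^ ((d : ℝ) / 2 - 1) * Real.Gamma ((d : ℝ) / 2)))) := by
  have h := (continuousOn_radialKernel hd 0 self_mem_Ici).mono_left
    (nhdsWithin_mono 0 Ioi_subset_Ici_self)
  have h0 : radialKernel d 0 = 1 / ((2 : ℝ) ^ ((d : ℝ) / 2 - 1) * Real.Gamma ((d : ℝ) / 2)) := by
    simp [radialKernel]
  rw [h0] at h
  refine h.congr' ?_
  filter_upwards [self_mem_nhdsWithin] with s (hs : 0 < s)
  simp [radialKernel, hs.ne']

theorem integrableOn_radialKernel_mul {d : ℕ} (hd : 1 ≤ d) {ρ : ℝ} (hρ : 0 ≤ ρ) {h : ℝ → ℝ}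
    (hh : IntegrableOn h (Ioi 0)) :
    IntegrableOn (fun ξ => radialKernel d (ρ * ξ) * h ξ) (Ioi 0) := by
  obtain ⟨B, hB⟩ := exists_abs_radialKernel_le hd
  refine Integrable.bdd_mul (c := B) hh ?_ ?_
  · refine ContinuousOn.aestronglyMeasurable ?_ measurableSet_Ioi
    exact (continuousOn_radialKernel hd).comp (by fun_prop)
      fun ξ hξ => mul_nonneg hρ (le_of_lt hξ)
  · exact (ae_restrict_mem measurableSet_Ioi).mono fun ξ hξ => hB _ (mul_nonneg hρ (le_of_lt hξ))

/-! ### The unitary Fourier transform: radial functions, multiplication formula, Plancherel -/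

open Metric in
/-- The Fourier transform of a radial function. -/
theorem fourierT_radial {d : ℕ} (hd : 1 ≤ d) {g : ℝ → ℝ}
    (hg : Integrable fun x : E d => (g ‖x‖ : ℂ)) (k : E d) :
    fourierT (fun x : E d => (g ‖x‖ : ℂ)) k =
      ((∫ ξ in Ioi (0 : ℝ), radialKernel d (‖k‖ * ξ) * (ξ ^ (d - 1) * g ξ) : ℝ) : ℂ) := by
  -- At `k = 0` any unit vector serves as direction.
  obtain ⟨e, he, hke⟩ : ∃ e : E d, ‖e‖ = 1 ∧ k = ‖k‖ • e := by
    by_cases hk : k = 0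
    · exact ⟨EuclideanSpace.single ⟨0, hd⟩ 1, by simp, by simp [hk]⟩
    · exact ⟨‖k‖⁻¹ • k, norm_smul_inv_norm hk, by
        rw [smul_smul, mul_inv_cancel₀ (norm_ne_zero_iff.2 hk), one_smul]⟩
  have hint : Integrable fun x : E d =>
      Complex.exp (-(Complex.I * ((inner ℝ k x : ℝ) : ℂ))) * (g ‖x‖ : ℂ) := by
    refine hg.bdd_mul (c := 1) (Continuous.aestronglyMeasurable (by fun_prop))
      (.of_forall fun x => ?_)
    rw [← mul_neg, ← Complex.ofReal_neg, mul_comm, Complex.norm_exp_ofReal_mul_I]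
  rw [fourierT, integral_polar hd hint, ← integral_complex_ofReal, ← integral_const_mul]
  refine setIntegral_congr_fun measurableSet_Ioi fun ξ (hξ : 0 < ξ) => ?_
  have h1 : ∀ ω : sphere (0 : E d) 1,
      Complex.exp (-(Complex.I * ((inner ℝ k (ξ • (ω : E d)) : ℝ) : ℂ))) *
        (g ‖ξ • (ω : E d)‖ : ℂ) =
      Complex.exp (-(Complex.I * ((‖k‖ * ξ * inner ℝ (ω : E d) e : ℝ) : ℂ))) * (g ξ : ℂ) := by
    intro ω
    have : inner ℝ k (ξ • (ω : E d)) = ‖k‖ * ξ * inner ℝ (ω : E d) e := by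
      conv_lhs => rw [hke]
      rw [real_inner_smul_left, real_inner_smul_right, real_inner_comm, mul_assoc]
    rw [this, norm_smul, norm_eq_of_mem_sphere, mul_one, Real.norm_of_nonneg hξ.le]
  simp only [h1, integral_mul_const]
  have h2 := sphere_exp_eq_radialKernel hd he (mul_nonneg (norm_nonneg k) hξ.le)
  push_cast at h2 ⊢
  rw [← h2, Complex.real_smul]
  push_cast
  ring

theorem fourierT_eq_fourier {d : ℕ} (φ : E d → ℂ) (k : E d) :
    fourierT φ k = (((2 * Real.pi) ^ (-(d : ℝ) / 2) : ℝ) : ℂ) * 𝓕 φ ((2 * Real.pi)⁻¹ • k) := by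
  rw [fourierT, Real.fourier_eq']
  congr 2
  funext x
  rw [smul_eq_mul, real_inner_smul_right, real_inner_comm]
  congr 2
  push_cast
  have : (Real.pi : ℂ) ≠ 0 := by exact_mod_cast Real.pi_ne_zero
  field_simp

theorem integral_fourierT_mul {d : ℕ} {f g : E d → ℂ} (hf : Integrable f) (hg : Integrable g) :
    ∫ x, fourierT f x * g x = ∫ x, f x * fourierT g x := by
  -- Dividing the pairing by `2π` cancels the `2π` in `Real.fourierChar`; the pairing stays
  -- symmetric, which gives the self-adjoint form.
  set L : E d →ₗ[ℝ] E d →ₗ[ℝ] ℝ := (2 * Real.pi)⁻¹ • innerₗ (E d)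
  have hL : ∀ x y, L x y = (2 * Real.pi)⁻¹ * inner ℝ x y := fun x y => by simp [L]
  have hflip : L.flip = L := by
    ext x y
    simp [hL, real_inner_comm]
  have key : ∀ (φ : E d → ℂ) (k : E d), fourierT φ k = (((2 * Real.pi) ^ (-(d : ℝ) / 2) : ℝ) : ℂ) *
      VectorFourier.fourierIntegral Real.fourierChar volume L φ k := fun φ k => by
    rw [fourierT_eq_fourier, Real.fourier_eq, VectorFourier.fourierIntegral]
    simp only [hL, real_inner_smul_right]
  have h := VectorFourier.integral_fourierIntegral_smul_eq_flip (L := L)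
    Real.continuous_fourierChar (by simp only [hL]; fun_prop) hf hg
  simp only [smul_eq_mul, hflip] at h
  simp only [key, mul_assoc, mul_left_comm (f _), integral_const_mul, h]

theorem continuous_fourierT {d : ℕ} {f : E d → ℂ} (hf : Integrable f) :
    Continuous (fourierT f) := by
  have h : Continuous (𝓕 f) := VectorFourier.fourierIntegral_continuous
    Real.continuous_fourierChar (L := innerₗ (E d)) continuous_inner hf
  have : fourierT f = fun k => (((2 * Real.pi) ^ (-(d : ℝ) / 2) : ℝ) : ℂ) *
      𝓕 f ((2 * Real.pi)⁻¹ • k) := funext (fourierT_eq_fourier f)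
  rw [this]
  fun_prop

theorem exists_norm_fourierT_le {d : ℕ} (f : E d → ℂ) :
    ∃ B, ∀ k, ‖fourierT f k‖ ≤ B := by
  refine ⟨(2 * Real.pi) ^ (-(d : ℝ) / 2) * ∫ x, ‖f x‖, fun k => ?_⟩
  rw [fourierT_eq_fourier, norm_mul, Complex.norm_real, Real.norm_of_nonneg (by positivity)]
  gcongr
  exact VectorFourier.norm_fourierIntegral_le_integral_norm _ _ _ _ _

/-- Riemann–Lebesgue; for non-integrable `f` the transform is `0` by the convention for `∫`. -/
theorem tendsto_fourierT_cocompact {d : ℕ} (f : E d → ℂ) :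
    Tendsto (fourierT f) (cocompact (E d)) (𝓝 0) := by
  have h : Tendsto (𝓕 f) (cocompact (E d)) (𝓝 0) := tendsto_integral_exp_inner_smul_cocompact f
  have hc : Tendsto (fun k : E d => (2 * Real.pi)⁻¹ • k) (cocompact (E d)) (cocompact (E d)) :=
    (Homeomorph.smulOfNeZero (2 * Real.pi)⁻¹
      (by positivity)).isClosedEmbedding.tendsto_cocompact
  have := (h.comp hc).const_mul (((2 * Real.pi) ^ (-(d : ℝ) / 2) : ℝ) : ℂ)
  rw [mul_zero] at this
  exact this.congr fun k => (fourierT_eq_fourier f k).symm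

/-- Plancherel's theorem for the Fourier integral of functions in `L¹ ∩ L²`. -/
theorem fourier_memLp_two_and_eLpNorm_eq {d : ℕ} {f : E d → ℂ} (hf : Integrable f)
    (hf2 : MemLp f 2) : MemLp (𝓕 f) 2 ∧ eLpNorm (𝓕 f) 2 volume = eLpNorm f 2 volume := by
  set F : Lp ℂ 2 (volume : Measure (E d)) := hf2.toLp f
  have hcont : Continuous (𝓕 f) := VectorFourier.fourierIntegral_continuous
    Real.continuous_fourierChar (L := innerₗ (E d)) continuous_inner hf
  -- The `L²` extension and the Fourier integral have the same pairings with smooth compactly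
  -- supported functions, since both satisfy the multiplication formula.
  have hae : (𝓕 F : Lp ℂ 2 (volume : Measure (E d))) =ᵐ[volume] 𝓕 f := by
    refine ae_eq_of_integral_contDiff_smul_eq ((Lp.memLp _).locallyIntegrable one_le_two)
      hcont.locallyIntegrable fun g hg hgc => ?_
    have hg₁ : HasCompactSupport (Complex.ofRealCLM ∘ g) := hgc.comp_left rfl
    have hg₂ : ContDiff ℝ (⊤ : ℕ∞) (Complex.ofRealCLM ∘ g) := by fun_prop
    set φ : SchwartzMap (E d) ℂ := hg₁.toSchwartzMap hg₂
    have h1 := congrArg (fun T => T φ) (Lp.fourier_toTemperedDistribution_eq F)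
    simp only [TemperedDistribution.fourier_apply, Lp.toTemperedDistribution_apply] at h1
    have h2 : ∫ x, g x • (𝓕 F : Lp ℂ 2 (volume : Measure (E d))) x =
        ∫ x, φ x • (𝓕 F : Lp ℂ 2 (volume : Measure (E d))) x := rfl
    have h3 : ∫ x, g x • 𝓕 f x = ∫ x, φ x • 𝓕 f x := rfl
    rw [h2, h3, ← h1]
    have h4 : ∫ x, (𝓕 φ) x • F x = ∫ x, (𝓕 φ) x • f x :=
      integral_congr_ae (hf2.coeFn_toLp.mono fun x hx => by simp only [F, hx])
    rw [h4]
    simpa using! VectorFourier.integral_fourierIntegral_smul_eq_flip (L := innerₗ (E d))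
      Real.continuous_fourierChar continuous_inner φ.integrable hf
  refine ⟨(Lp.memLp _).ae_eq hae, ?_⟩
  rw [← eLpNorm_congr_ae hae, ← eLpNorm_congr_ae hf2.coeFn_toLp, ← Lp.enorm_def, ← Lp.enorm_def,
    enorm_eq_iff_norm_eq, Lp.norm_fourier_eq]

theorem eLpNorm_comp_smul {d : ℕ} (f : E d → ℂ) {c : ℝ} (hc : 0 < c) :
    eLpNorm (fun x => f (c • x)) 2 volume =
      ENNReal.ofReal (c ^ (-(d : ℝ) / 2)) * eLpNorm f 2 volume := by
  have h := (Homeomorph.smulOfNeZero c hc.ne' : E d ≃ₜ E d).measurableEmbedding.eLpNorm_map_measure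
    (μ := volume) (g := f) (p := 2)
  have h2 := Measure.map_addHaar_smul (volume : Measure (E d)) hc.ne'
  change eLpNorm f 2 (Measure.map (fun x => c • x) volume) = eLpNorm (fun x => f (c • x)) 2 volume
    at h
  rw [← h, h2, eLpNorm_smul_measure_of_ne_top (by simp), smul_eq_mul,
    ENNReal.ofReal_rpow_of_nonneg (by positivity) (by positivity)]
  congr 2
  rw [abs_of_nonneg (by positivity), finrank_euclideanSpace, Fintype.card_fin, ← Real.rpow_natCast,
    ← Real.rpow_neg hc.le, ← Real.rpow_mul hc.le]
  congr 1
  simp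
  ring

/-- Plancherel's theorem in the unitary normalization. -/
theorem fourierT_memLp_two_and_eLpNorm_eq {d : ℕ} {f : E d → ℂ} (hf : Integrable f)
    (hf2 : MemLp f 2) : MemLp (fourierT f) 2 ∧ eLpNorm (fourierT f) 2 volume = eLpNorm f 2 volume := by
  obtain ⟨-, h2⟩ := fourier_memLp_two_and_eLpNorm_eq hf hf2
  have h3 : fourierT f = (((2 * Real.pi) ^ (-(d : ℝ) / 2) : ℝ) : ℂ) •
      fun k => 𝓕 f ((2 * Real.pi)⁻¹ • k) := funext (fourierT_eq_fourier f)
  have h4 : eLpNorm (fourierT f) 2 volume = eLpNorm f 2 volume := by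
    rw [h3, eLpNorm_const_smul, eLpNorm_comp_smul _ (by positivity), h2, ← mul_assoc,
      ← ofReal_norm, Complex.norm_real, Real.norm_of_nonneg (by positivity),
      ← ENNReal.ofReal_mul (by positivity), ← Real.mul_rpow (by positivity) (by positivity),
      mul_inv_cancel₀ (by positivity)]
    simp
  exact ⟨⟨(continuous_fourierT hf).aestronglyMeasurable, h4 ▸ hf2.2⟩, h4⟩

/-- A bounded function in `L²` belongs to `L^p` for all `p ≥ 2`. -/
theorem memLp_of_bounded_of_memLp_two {d : ℕ} {f : E d → ℂ} (hf : MemLp f 2) {B : ℝ}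
    (hB : ∀ x, ‖f x‖ ≤ B) {p : ℝ≥0∞} (hp : 2 ≤ p) : MemLp f p := by
  by_cases htop : p = ⊤
  · exact htop ▸ memLp_top_of_bound hf.1 B (.of_forall hB)
  have hp0 : p ≠ 0 := (two_pos.trans_le hp).ne'
  have hp2 : 2 ≤ p.toReal := by
    simpa using (ENNReal.toReal_le_toReal (by simp) htop).2 hp
  rw [← integrable_norm_rpow_iff hf.1 hp0 htop]
  have h2 := (integrable_norm_rpow_iff hf.1 two_ne_zero (by simp)).2 hf
  refine (h2.const_mul (B ^ (p.toReal - 2))).mono' ?_ (.of_forall fun x => ?_)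
  · exact (hf.1.norm.aemeasurable.pow_const _).aestronglyMeasurable
  · rw [Real.norm_of_nonneg (by positivity), ENNReal.toReal_ofNat,
      show ‖f x‖ ^ p.toReal = ‖f x‖ ^ (p.toReal - 2) * ‖f x‖ ^ (2 : ℝ) by
        rw [← Real.rpow_add_of_nonneg (norm_nonneg _) (by linarith) (by norm_num)]; ring_nf]
    exact mul_le_mul_of_nonneg_right
      (Real.rpow_le_rpow (norm_nonneg _) (hB x) (by linarith)) (by positivity)

/-! ### Estimates for the Macdonald function -/

theorem exp_neg_le_rpow {p y : ℝ} (hp : 0 < p) (hy : 0 < y) :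
    Real.exp (-y) ≤ p ^ p * y ^ (-p) := by
  have h1 : y ≤ p * Real.exp (y / p) := by
    have := Real.add_one_le_exp (y / p)
    calc y = p * (y / p) := by field_simp
      _ ≤ p * Real.exp (y / p) := by gcongr; linarith
  have h2 : y ^ p ≤ p ^ p * Real.exp y := by
    calc y ^ p ≤ (p * Real.exp (y / p)) ^ p := by gcongr
      _ = p ^ p * Real.exp y := by
        rw [Real.mul_rpow hp.le (Real.exp_pos _).le, ← Real.exp_mul, div_mul_cancel₀ _ hp.ne']
  rw [Real.rpow_neg hy.le, Real.exp_neg, ← div_eq_mul_inv, inv_eq_one_div,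
    div_le_div_iff₀ (Real.exp_pos _) (by positivity)]
  linarith

/-- Averaging `cosh t ≥ 1` and `cosh t ≥ e^t / 2` gives the factors `e^(-s/2)` and `e^(-s e^t / 4)`.
A power bound of order `ν + 1/4` on the second beats `cosh (ν t) ≤ e^(ν t)` and leaves `e^(-t/4)`.
The excess `1/4` covers the logarithm at `ν = 0`; being below `1/2`, it keeps `K_ν²` integrable
against the weights used later, even for `d = 1`. -/
theorem macdonaldK_integrand_le {ν s t : ℝ} (hν : 0 ≤ ν) (hs : 0 < s) (ht : 0 ≤ t) :
    Real.exp (-(s * Real.cosh t)) * Real.cosh (ν * t) ≤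
      (ν + 1 / 4) ^ (ν + 1 / 4) * 4 ^ (ν + 1 / 4) *
        (s ^ (-(ν + 1 / 4)) * Real.exp (-(s / 2))) * Real.exp (-(1 / 4) * t) := by
  set p := ν + 1 / 4 with hp
  have hp0 : 0 < p := by positivity
  have h1 : Real.cosh (ν * t) ≤ Real.exp (ν * t) := by
    rw [Real.cosh_eq]
    have : Real.exp (-(ν * t)) ≤ Real.exp (ν * t) :=
      Real.exp_le_exp.2 (by have := mul_nonneg hν ht; linarith)
    linarith
  have h2 : -(s * Real.cosh t) ≤ -(s / 2) + -(s * Real.exp t / 4) := by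
    have h3 : 1 ≤ Real.cosh t := Real.one_le_cosh t
    have h4 : Real.exp t / 2 ≤ Real.cosh t := by
      rw [Real.cosh_eq]; have := Real.exp_pos (-t); linarith
    nlinarith
  calc Real.exp (-(s * Real.cosh t)) * Real.cosh (ν * t)
      ≤ Real.exp (-(s / 2) + -(s * Real.exp t / 4)) * Real.exp (ν * t) := by
        gcongr
    _ ≤ (Real.exp (-(s / 2)) * (p ^ p * (s * Real.exp t / 4) ^ (-p))) * Real.exp (ν * t) := by
        rw [Real.exp_add]
        gcongr
        exact exp_neg_le_rpow hp0 (by positivity)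
    _ = _ := by
        have h5 : (s * Real.exp t / 4) ^ (-p) = s ^ (-p) * Real.exp (t * -p) * 4 ^ p := by
          rw [Real.div_rpow (by positivity) (by positivity), Real.mul_rpow hs.le (by positivity),
            ← Real.exp_mul, Real.rpow_neg (by norm_num : (0 : ℝ) ≤ 4), div_inv_eq_mul]
        have h6 : Real.exp (-(1 / 4) * t) = Real.exp (t * -p) * Real.exp (ν * t) := by
          rw [← Real.exp_add]; congr 1; rw [hp]; ring
        rw [h5, h6]
        ring

theorem integrableOn_macdonaldK_integrand {ν s : ℝ} (hν : 0 ≤ ν) (hs : 0 < s) :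
    IntegrableOn (fun t => Real.exp (-(s * Real.cosh t)) * Real.cosh (ν * t)) (Ioi 0) := by
  refine Integrable.mono' ((integrableOn_exp_mul_Ioi (a := -(1 / 4)) (by norm_num) 0).const_mul
    ((ν + 1 / 4) ^ (ν + 1 / 4) * 4 ^ (ν + 1 / 4) * (s ^ (-(ν + 1 / 4)) * Real.exp (-(s / 2)))))
    (Continuous.aestronglyMeasurable (by fun_prop)) ?_
  refine (ae_restrict_mem measurableSet_Ioi).mono fun t (ht : 0 < t) => ?_
  rw [Real.norm_of_nonneg (by positivity)]
  exact macdonaldK_integrand_le hν hs ht.le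

theorem exists_macdonaldK_le {ν : ℝ} (hν : 0 ≤ ν) :
    ∃ C, 0 ≤ C ∧ ∀ s, 0 < s →
      macdonaldK ν s ≤ C * (s ^ (-(ν + 1 / 4)) * Real.exp (-(s / 2))) := by
  refine ⟨(ν + 1 / 4) ^ (ν + 1 / 4) * 4 ^ (ν + 1 / 4) * ∫ t in Ioi (0 : ℝ), Real.exp (-(1 / 4) * t),
    by positivity, fun s hs => ?_⟩
  have h := setIntegral_mono_on (integrableOn_macdonaldK_integrand hν hs)
    ((integrableOn_exp_mul_Ioi (a := -(1 / 4)) (by norm_num) 0).const_mul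
      ((ν + 1 / 4) ^ (ν + 1 / 4) * 4 ^ (ν + 1 / 4) * (s ^ (-(ν + 1 / 4)) * Real.exp (-(s / 2)))))
    measurableSet_Ioi fun t (ht : 0 < t) => macdonaldK_integrand_le hν hs ht.le
  rw [integral_const_mul] at h
  exact h.trans_eq (by ring)

theorem macdonaldK_pos {ν s : ℝ} (hν : 0 ≤ ν) (hs : 0 < s) : 0 < macdonaldK ν s := by
  rw [macdonaldK, setIntegral_pos_iff_support_of_nonneg_ae (.of_forall fun t => by
    simp only [Pi.zero_apply]; positivity) (integrableOn_macdonaldK_integrand hν hs)]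
  have : Function.support (fun t => Real.exp (-(s * Real.cosh t)) * Real.cosh (ν * t)) = univ :=
    eq_univ_of_forall fun t => (by positivity :
      Real.exp (-(s * Real.cosh t)) * Real.cosh (ν * t) ≠ 0)
  simp [this]

theorem measurable_macdonaldK (ν : ℝ) : Measurable (macdonaldK ν) := by
  have h : StronglyMeasurable (fun p : ℝ × ℝ =>
      Real.exp (-(p.1 * Real.cosh p.2)) * Real.cosh (ν * p.2)) :=
    Continuous.stronglyMeasurable (by fun_prop)
  exact (h.integral_prod_right (ν := volume.restrict (Ioi 0))).measurable

/-- Near `0` the bound on `K_ν` leaves a power above `-1`, at infinity it decays exponentially, and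
the denominator is at least `(ε²)^q`. The case `m = 1` serves `L¹` and `M`, the case `m = 2` serves
`L²`, `U` and `V`. -/
theorem integrableOn_rpow_mul_macdonaldK_pow_div {ν a q ε : ℝ} {m : ℕ} (hν : 0 ≤ ν) (hq : 0 ≤ q)
    (hε : 0 < ε) (hm : m ≠ 0) (ha : m * (ν + 1 / 4) - 1 < a) :
    IntegrableOn (fun ξ => ξ ^ a * macdonaldK ν ξ ^ m / (ξ ^ 2 + ε ^ 2) ^ q) (Ioi 0) := by
  obtain ⟨C, hC, hK⟩ := exists_macdonaldK_le hν
  have hm' : (0 : ℝ) < m := by exact_mod_cast Nat.pos_of_ne_zero hm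
  have hint : IntegrableOn (fun ξ => ξ ^ (a - m * (ν + 1 / 4)) *
      Real.exp (-(m / 2 : ℝ) * ξ ^ (1 : ℝ))) (Ioi 0) :=
    integrableOn_rpow_mul_exp_neg_mul_rpow (by linarith) one_pos (by positivity)
  refine Integrable.mono' (hint.const_mul (C ^ m * ((ε ^ 2) ^ q)⁻¹)) ?_ ?_
  · have := measurable_macdonaldK ν
    exact Measurable.aestronglyMeasurable (by fun_prop)
  · refine (ae_restrict_mem measurableSet_Ioi).mono fun ξ (hξ : 0 < ξ) => ?_
    have hKp := macdonaldK_pos hν hξ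
    have h1 : (ε ^ 2) ^ q ≤ (ξ ^ 2 + ε ^ 2) ^ q := by gcongr; nlinarith
    have h2 : ξ ^ (a - m * (ν + 1 / 4)) = ξ ^ a * (ξ ^ (-(ν + 1 / 4))) ^ m := by
      rw [← Real.rpow_natCast, ← Real.rpow_mul hξ.le, ← Real.rpow_add hξ]; ring_nf
    have h3 : Real.exp (-(m / 2 : ℝ) * ξ ^ (1 : ℝ)) = Real.exp (-(ξ / 2)) ^ m := by
      rw [← Real.exp_nat_mul, Real.rpow_one]; ring_nf
    rw [Real.norm_of_nonneg (by positivity), div_eq_mul_inv]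
    calc ξ ^ a * macdonaldK ν ξ ^ m * ((ξ ^ 2 + ε ^ 2) ^ q)⁻¹
        ≤ ξ ^ a * (C * (ξ ^ (-(ν + 1 / 4)) * Real.exp (-(ξ / 2)))) ^ m * ((ε ^ 2) ^ q)⁻¹ := by
          gcongr
          exact hK ξ hξ
      _ = _ := by rw [h2, h3]; ring

/-! ### Integrals and norms of radial functions -/

theorem finrank_mul_volume_ball {d : ℕ} (hd : 1 ≤ d) :
    (d : ℝ) * (volume : Measure (E d)).real (Metric.ball 0 1) = sphereArea d := by
  have : Nonempty (Fin d) := ⟨⟨0, hd⟩⟩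
  have hd' : (0 : ℝ) < d := by exact_mod_cast hd
  have hG : 0 < Real.Gamma ((d : ℝ) / 2) := Real.Gamma_pos_of_pos (by positivity)
  rw [Measure.real, EuclideanSpace.volume_ball, Fintype.card_fin, sphereArea,
    Real.Gamma_add_one (by positivity), ENNReal.ofReal_one, one_pow, one_mul,
    ENNReal.toReal_ofReal (by positivity), Real.sqrt_eq_rpow, ← Real.rpow_natCast,
    ← Real.rpow_mul Real.pi_pos.le, one_div_mul_eq_div]
  field_simp

theorem sphereArea_pos {d : ℕ} (hd : 1 ≤ d) : 0 < sphereArea d := by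
  have hd' : (0 : ℝ) < d := by exact_mod_cast hd
  have hG : 0 < Real.Gamma ((d : ℝ) / 2) := Real.Gamma_pos_of_pos (by positivity)
  unfold sphereArea
  positivity

theorem rpow_natCast_sub_one {d : ℕ} (hd : 1 ≤ d) (ξ : ℝ) : ξ ^ ((d : ℝ) - 1) = ξ ^ (d - 1) := by
  rw [← Real.rpow_natCast, Nat.cast_sub hd, Nat.cast_one]

theorem integral_radial {d : ℕ} (hd : 1 ≤ d) (f : ℝ → ℝ) :
    ∫ x : E d, f ‖x‖ = sphereArea d * ∫ ξ in Ioi (0 : ℝ), ξ ^ ((d : ℝ) - 1) * f ξ := by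
  have : Nonempty (Fin d) := ⟨⟨0, hd⟩⟩
  simp only [rpow_natCast_sub_one hd]
  rw [integral_fun_norm_addHaar, finrank_euclideanSpace, Fintype.card_fin, nsmul_eq_mul,
    smul_eq_mul, ← mul_assoc, finrank_mul_volume_ball hd]
  simp

theorem integrable_radial_iff {d : ℕ} (hd : 1 ≤ d) (f : ℝ → ℝ) :
    Integrable (fun x : E d => f ‖x‖) ↔
      IntegrableOn (fun ξ => ξ ^ ((d : ℝ) - 1) * f ξ) (Ioi 0) := by
  have : Nonempty (Fin d) := ⟨⟨0, hd⟩⟩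
  simp only [rpow_natCast_sub_one hd]
  rw [integrable_fun_norm_addHaar, finrank_euclideanSpace, Fintype.card_fin]
  simp

/-- The `L^p` norm of a radial function. -/
theorem eLpNorm_radial {d : ℕ} (hd : 1 ≤ d) {f : ℝ → ℝ} {p : ℝ≥0∞} (hp0 : p ≠ 0) (hp : p ≠ ⊤)
    (hf : MemLp (fun x : E d => (f ‖x‖ : ℂ)) p) :
    eLpNorm (fun x : E d => (f ‖x‖ : ℂ)) p volume = ENNReal.ofReal ((sphereArea d *
      ∫ ξ in Ioi (0 : ℝ), ξ ^ ((d : ℝ) - 1) * |f ξ| ^ p.toReal) ^ (1 / p.toReal)) := by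
  rw [hf.eLpNorm_eq_integral_rpow_norm hp0 hp, ← integral_radial hd fun ξ => |f ξ| ^ p.toReal]
  simp

/-! ### Fractional Laplacian and trial profiles in frequency space -/

/-- Here `f` and `g` live on the frequency side. The multiplication formula moves the transform onto
the test functions, where the factor `‖k‖^s` passes from `f` to `φ`. -/
theorem isFracLaplacian_fourierT {d : ℕ} {s : ℝ} {f g : E d → ℂ} (hf : Integrable f)
    (hg : Integrable g) (h : ∀ k, g k = ((‖k‖ ^ s : ℝ) : ℂ) * f k) :
    IsFracLaplacian s (fourierT f) (fourierT g) := by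
  intro φ χ _ _ hχ
  rw [integral_fourierT_mul hg φ.integrable, integral_fourierT_mul hf χ.integrable]
  congr 1
  funext k
  rw [h, hχ]
  ring

/-- The radial profile of the Fourier transforms of the trial functions. -/
noncomputable def trialProfile (ν q ε a ξ : ℝ) : ℝ :=
  ξ ^ a * macdonaldK ν ξ / (ξ ^ 2 + ε ^ 2) ^ q

/-- The family is stable under `D^s`, which shifts `a` by `s`. Nonnegative exponents make the
identity hold at `ξ = 0` too, with `0^0 = 1`. -/
theorem rpow_mul_trialProfile {ν q ε a s ξ : ℝ} (hξ : 0 ≤ ξ) (ha : 0 ≤ a) (hs : 0 ≤ s) :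
    ξ ^ s * trialProfile ν q ε a ξ = trialProfile ν q ε (s + a) ξ := by
  rw [trialProfile, trialProfile, Real.rpow_add_of_nonneg hξ hs ha]
  ring

theorem integrable_trialProfile {d : ℕ} (hd : 1 ≤ d) {ν q ε a : ℝ} (hν : 0 ≤ ν) (hq : 0 ≤ q)
    (hε : 0 < ε) (ha : ν ≤ a) :
    Integrable fun x : E d => (trialProfile ν q ε a ‖x‖ : ℂ) := by
  have hd' : (1 : ℝ) ≤ d := by exact_mod_cast hd
  refine Integrable.ofReal ((integrable_radial_iff hd (trialProfile ν q ε a)).2 ?_)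
  refine (integrableOn_rpow_mul_macdonaldK_pow_div (a := d - 1 + a) (m := 1) hν hq hε
    one_ne_zero (by push_cast; linarith)).congr_fun (fun ξ (hξ : 0 < ξ) => ?_) measurableSet_Ioi
  simp only [trialProfile, Real.rpow_add hξ, pow_one]
  ring

theorem rpow_mul_trialProfile_sq {d : ℕ} {ν q ε a ξ : ℝ} (hξ : 0 < ξ) :
    ξ ^ ((d : ℝ) - 1) * |trialProfile ν q ε a ξ| ^ (2 : ℝ) =
      ξ ^ (2 * a + d - 1) * macdonaldK ν ξ ^ 2 / (ξ ^ 2 + ε ^ 2) ^ (2 * q) := by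
  have h1 : (ξ ^ 2 + ε ^ 2) ^ (2 * q) = ((ξ ^ 2 + ε ^ 2) ^ q) ^ 2 := by
    rw [mul_comm, Real.rpow_mul (by positivity)]; norm_num
  have h2 : ξ ^ (2 * a + d - 1) = ξ ^ ((d : ℝ) - 1) * (ξ ^ a) ^ 2 := by
    rw [← Real.rpow_natCast (ξ ^ a), ← Real.rpow_mul hξ.le, ← Real.rpow_add hξ]
    push_cast
    ring_nf
  rw [h1, h2, Real.rpow_two, sq_abs, trialProfile]
  ring

theorem memLp_two_trialProfile {d : ℕ} (hd : 1 ≤ d) {ν q ε a : ℝ} (hν : 0 ≤ ν) (hq : 0 ≤ q)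
    (hε : 0 < ε) (ha : ν ≤ a) :
    MemLp (fun x : E d => (trialProfile ν q ε a ‖x‖ : ℂ)) 2 := by
  have hd' : (1 : ℝ) ≤ d := by exact_mod_cast hd
  rw [← integrable_norm_rpow_iff (integrable_trialProfile hd hν hq hε ha).1 two_ne_zero (by simp)]
  simp only [Complex.norm_real, Real.norm_eq_abs, ENNReal.toReal_ofNat]
  refine (integrable_radial_iff hd fun ξ => |trialProfile ν q ε a ξ| ^ (2 : ℝ)).2 ?_
  refine (integrableOn_rpow_mul_macdonaldK_pow_div (a := 2 * a + d - 1) (m := 2) (q := 2 * q)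
    hν (by positivity) hε two_ne_zero (by push_cast; linarith)).congr_fun
    (fun ξ (hξ : 0 < ξ) => (rpow_mul_trialProfile_sq hξ).symm) measurableSet_Ioi

theorem eLpNorm_fourierT_trialProfile {d : ℕ} (hd : 1 ≤ d) {ν q ε a : ℝ} (hν : 0 ≤ ν) (hq : 0 ≤ q)
    (hε : 0 < ε) (ha : ν ≤ a) :
    eLpNorm (fourierT fun x : E d => (trialProfile ν q ε a ‖x‖ : ℂ)) 2 volume =
      ENNReal.ofReal ((sphereArea d * ∫ ξ in Ioi (0 : ℝ),
        ξ ^ (2 * a + d - 1) * macdonaldK ν ξ ^ 2 / (ξ ^ 2 + ε ^ 2) ^ (2 * q)) ^ ((1 : ℝ) / 2)) := by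
  have h2 := memLp_two_trialProfile hd hν hq hε ha
  rw [(fourierT_memLp_two_and_eLpNorm_eq (integrable_trialProfile hd hν hq hε ha) h2).2,
    eLpNorm_radial hd two_ne_zero (by simp) h2, ENNReal.toReal_ofNat,
    setIntegral_congr_fun measurableSet_Ioi fun ξ hξ => rpow_mul_trialProfile_sq hξ]

theorem integral_rpow_mul_macdonaldK_sq_div_pos {ν a q ε : ℝ} (hν : 0 ≤ ν) (hε : 0 < ε)
    (h : IntegrableOn (fun ξ => ξ ^ a * macdonaldK ν ξ ^ 2 / (ξ ^ 2 + ε ^ 2) ^ q) (Ioi 0)) :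
    0 < ∫ ξ in Ioi (0 : ℝ), ξ ^ a * macdonaldK ν ξ ^ 2 / (ξ ^ 2 + ε ^ 2) ^ q := by
  have hpos : ∀ ξ ∈ Ioi (0 : ℝ), 0 < ξ ^ a * macdonaldK ν ξ ^ 2 / (ξ ^ 2 + ε ^ 2) ^ q :=
    fun ξ (hξ : 0 < ξ) => by
      have := macdonaldK_pos hν hξ
      positivity
  rw [setIntegral_pos_iff_support_of_nonneg_ae
    ((ae_restrict_mem measurableSet_Ioi).mono fun ξ hξ => (hpos ξ hξ).le) h,
    inter_eq_self_of_subset_right fun ξ hξ => Function.mem_support.2 (hpos ξ hξ).ne']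
  simp

/-- For a continuous function the set exceeding the essential supremum is open and null, hence
empty; every `ρ ≥ 0` is the norm of some vector. -/
theorem sSup_image_le_eLpNorm_top {d : ℕ} (hd : 1 ≤ d) {f : ℝ → ℝ}
    (hf : Continuous fun x : E d => (f ‖x‖ : ℂ)) :
    ENNReal.ofReal (sSup ((fun ρ => |f ρ|) '' Ici 0)) ≤
      eLpNorm (fun x : E d => (f ‖x‖ : ℂ)) ⊤ volume := by
  by_cases htop : eLpNorm (fun x : E d => (f ‖x‖ : ℂ)) ⊤ volume = ⊤
  · simp [htop]
  refine ENNReal.ofReal_le_of_le_toReal (csSup_le (nonempty_Ici.image _) ?_)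
  rintro _ ⟨ρ, hρ : 0 ≤ ρ, rfl⟩
  set S := eLpNorm (fun x : E d => (f ‖x‖ : ℂ)) ⊤ volume
  have hae : ∀ᵐ x : E d, ‖(f ‖x‖ : ℂ)‖ ≤ S.toReal := by
    filter_upwards [ae_le_eLpNormEssSup (f := fun x : E d => (f ‖x‖ : ℂ)) (μ := volume)] with x hx
    rw [← toReal_enorm]
    exact ENNReal.toReal_mono htop (by rwa [← eLpNorm_exponent_top] at hx)
  have hopen : IsOpen {x : E d | ¬ ‖(f ‖x‖ : ℂ)‖ ≤ S.toReal} := by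
    simp only [not_le]
    exact isOpen_lt continuous_const hf.norm
  have hempty := hopen.measure_eq_zero_iff volume |>.1 (ae_iff.1 hae)
  have hx : ‖(EuclideanSpace.single ⟨0, hd⟩ ρ : E d)‖ = ρ := by simp [abs_of_nonneg hρ]
  by_contra hcon
  refine (hempty ▸ notMem_empty _ : (EuclideanSpace.single ⟨0, hd⟩ ρ : E d) ∉
    {x : E d | ¬ ‖(f ‖x‖ : ℂ)‖ ≤ S.toReal}) ?_
  simpa [hx] using hcon

theorem two_le_rExp {d : ℕ} {j n θ : ℝ} (h : 0 ≤ θ * n - j) : 2 ≤ rExp d j n θ := by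
  rw [rExp, ENNReal.le_inv_iff_le_inv]
  have : (0 : ℝ) ≤ (θ * n - j) / d := by positivity
  calc ENNReal.ofReal (1 / 2 - (θ * n - j) / d) ≤ ENNReal.ofReal (1 / 2) :=
        ENNReal.ofReal_le_ofReal (by linarith)
    _ = 2⁻¹ := by rw [one_div, ENNReal.ofReal_inv_of_pos two_pos, ENNReal.ofReal_ofNat]

/-! ### The functions `U`, `V`, `M`, `Y` of the trial family and the lower bound -/

section TrialFunctions

variable {d : ℕ} {j n ε : ℝ}

theorem integrandM_eq (hd : 1 ≤ d) {ρ ξ : ℝ} (hξ : 0 < ξ) :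
    integrandM d j n ε ρ ξ = radialKernel d (ρ * ξ) *
      (ξ ^ (d - 1) * trialProfile (n - j) (n - j / 2) ε n ξ) := by
  rw [integrandM, trialProfile, ← rpow_natCast_sub_one hd, add_sub_assoc, Real.rpow_add hξ]
  ring

theorem integrableOn_integrandM (hd : 1 ≤ d) (hj : 0 ≤ j) (hjn : j ≤ n) (hε : 0 < ε) {ρ : ℝ}
    (hρ : 0 ≤ ρ) : IntegrableOn (integrandM d j n ε ρ) (Ioi 0) := by
  have hd' : (1 : ℝ) ≤ d := by exact_mod_cast hd
  refine integrableOn_radialKernel_mul hd hρ ?_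
  simpa only [pow_one] using integrableOn_rpow_mul_macdonaldK_pow_div (a := n + d - 1)
    (m := 1) (q := n - j / 2) (sub_nonneg.2 hjn) (by linarith) hε one_ne_zero
    (by push_cast; linarith)

theorem fourierT_trialProfile_eq_M (hd : 1 ≤ d) (hj : 0 ≤ j) (hjn : j ≤ n) (hε : 0 < ε) :
    (fourierT fun x : E d => (trialProfile (n - j) (n - j / 2) ε n ‖x‖ : ℂ)) =
      fun k => (M d j n ε ‖k‖ : ℂ) := by
  funext k
  rw [fourierT_radial hd (integrable_trialProfile hd (by linarith) (by linarith) hε (by linarith)),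
    M, setIntegral_congr_fun measurableSet_Ioi fun ξ hξ => (integrandM_eq hd hξ).symm]

theorem continuous_M_norm (hd : 1 ≤ d) (hj : 0 ≤ j) (hjn : j ≤ n) (hε : 0 < ε) :
    Continuous fun x : E d => (M d j n ε ‖x‖ : ℂ) :=
  fourierT_trialProfile_eq_M hd hj hjn hε ▸ continuous_fourierT
    (integrable_trialProfile hd (by linarith) (by linarith) hε (by linarith))

theorem continuousOn_M (hd : 1 ≤ d) (hj : 0 ≤ j) (hjn : j ≤ n) (hε : 0 < ε) :
    ContinuousOn (M d j n ε) (Ici 0) := by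
  -- `M` is read off along a ray from the continuous function `x ↦ M(‖x‖)`.
  have h : Continuous fun ρ : ℝ =>
      (M d j n ε ‖ρ • (EuclideanSpace.single ⟨0, hd⟩ 1 : E d)‖ : ℂ).re :=
    Complex.continuous_re.comp ((continuous_M_norm hd hj hjn hε).comp (by fun_prop))
  exact h.continuousOn.congr fun ρ (hρ : 0 ≤ ρ) => by simp [norm_smul, abs_of_nonneg hρ]

theorem exists_norm_M_le (hd : 1 ≤ d) (hj : 0 ≤ j) (hjn : j ≤ n) (hε : 0 < ε) :
    ∃ B, ∀ x : E d, ‖(M d j n ε ‖x‖ : ℂ)‖ ≤ B := by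
  obtain ⟨B, hB⟩ := exists_norm_fourierT_le
    fun x : E d => (trialProfile (n - j) (n - j / 2) ε n ‖x‖ : ℂ)
  rw [fourierT_trialProfile_eq_M hd hj hjn hε] at hB
  exact ⟨B, hB⟩

theorem bddAbove_abs_M (hd : 1 ≤ d) (hj : 0 ≤ j) (hjn : j ≤ n) (hε : 0 < ε) :
    BddAbove ((fun ρ => |M d j n ε ρ|) '' Ici 0) := by
  obtain ⟨B, hB⟩ := exists_norm_M_le hd hj hjn hε
  refine ⟨B, ?_⟩
  rintro _ ⟨ρ, hρ : 0 ≤ ρ, rfl⟩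
  simpa [abs_of_nonneg hρ] using hB (EuclideanSpace.single ⟨0, hd⟩ ρ)

/-- As the transform of a function in `L¹ ∩ L²`, it is bounded and in `L²`, hence in every `L^p`
with `p ≥ 2`. -/
theorem memLp_M_norm (hd : 1 ≤ d) (hj : 0 ≤ j) (hjn : j ≤ n) (hε : 0 < ε) {p : ℝ≥0∞}
    (hp : 2 ≤ p) : MemLp (fun x : E d => (M d j n ε ‖x‖ : ℂ)) p := by
  obtain ⟨B, hB⟩ := exists_norm_M_le hd hj hjn hε
  refine memLp_of_bounded_of_memLp_two ?_ hB hp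
  rw [← fourierT_trialProfile_eq_M hd hj hjn hε]
  exact (fourierT_memLp_two_and_eLpNorm_eq
    (integrable_trialProfile hd (by linarith) (by linarith) hε (by linarith))
    (memLp_two_trialProfile hd (by linarith) (by linarith) hε (by linarith))).1

theorem memLL_M_norm (hd : 1 ≤ d) (hj : 0 ≤ j) (hjn : j ≤ n) (hε : 0 < ε) {p : ℝ≥0∞}
    (hp : 2 ≤ p) : MemLL p (fun x : E d => (M d j n ε ‖x‖ : ℂ)) := by
  unfold MemLL
  split_ifs
  · refine ⟨continuous_M_norm hd hj hjn hε, ?_⟩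
    rw [← fourierT_trialProfile_eq_M hd hj hjn hε]
    exact tendsto_fourierT_cocompact _
  · exact memLp_M_norm hd hj hjn hε hp

theorem integrableOn_integrandY (hd : 1 ≤ d) (hj : 0 ≤ j) (hjn : j ≤ n) (hε : 0 < ε) {θ : ℝ}
    (hθ : 0 ≤ θ * n - j) (hr : rExp d j n θ ≠ ⊤) :
    IntegrableOn (integrandY d j n θ ε) (Ioi 0) := by
  have h2 := two_le_rExp (d := d) hθ
  have h := memLp_M_norm hd hj hjn hε h2
  rw [← integrable_norm_rpow_iff h.1 (two_pos.trans_le h2).ne' hr] at h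
  simp only [Complex.norm_real, Real.norm_eq_abs] at h
  exact (integrable_radial_iff hd fun ρ => |M d j n ε ρ| ^ (rExp d j n θ).toReal).1 h

theorem ofReal_Y_le_eLpNorm (hd : 1 ≤ d) (hj : 0 ≤ j) (hjn : j ≤ n) (hε : 0 < ε) {θ : ℝ}
    (hθ : 0 ≤ θ * n - j) : ENNReal.ofReal (Y d j n θ ε) ≤
      eLpNorm (fun x : E d => (M d j n ε ‖x‖ : ℂ)) (rExp d j n θ) volume := by
  have h2 := two_le_rExp (d := d) hθ
  unfold Y
  split_ifs with hr
  · rw [hr]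
    exact sSup_image_le_eLpNorm_top hd (continuous_M_norm hd hj hjn hε)
  · rw [eLpNorm_radial hd (two_pos.trans_le h2).ne' hr (memLp_M_norm hd hj hjn hε h2)]
    rfl

theorem integrandU_eq : integrandU d j n ε = fun ξ => ξ ^ (2 * (n - j) + d - 1) *
    macdonaldK (n - j) ξ ^ 2 / (ξ ^ 2 + ε ^ 2) ^ (2 * (n - j / 2)) := by
  funext ξ
  rw [integrandU]
  ring_nf

theorem integrandV_eq : integrandV d j n ε = fun ξ => ξ ^ (2 * (n + (n - j)) + d - 1) *
    macdonaldK (n - j) ξ ^ 2 / (ξ ^ 2 + ε ^ 2) ^ (2 * (n - j / 2)) := by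
  funext ξ
  rw [integrandV]
  ring_nf

theorem integrableOn_integrandU (hd : 1 ≤ d) (hj : 0 ≤ j) (hjn : j ≤ n) (hε : 0 < ε) :
    IntegrableOn (integrandU d j n ε) (Ioi 0) := by
  have hd' : (1 : ℝ) ≤ d := by exact_mod_cast hd
  rw [integrandU_eq]
  exact integrableOn_rpow_mul_macdonaldK_pow_div (sub_nonneg.2 hjn) (by linarith) hε two_ne_zero
    (by push_cast; linarith)

theorem integrableOn_integrandV (hd : 1 ≤ d) (hj : 0 ≤ j) (hjn : j ≤ n) (hε : 0 < ε) :
    IntegrableOn (integrandV d j n ε) (Ioi 0) := by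
  have hd' : (1 : ℝ) ≤ d := by exact_mod_cast hd
  rw [integrandV_eq]
  exact integrableOn_rpow_mul_macdonaldK_pow_div (sub_nonneg.2 hjn) (by linarith) hε two_ne_zero
    (by push_cast; linarith)

theorem U_pos (hd : 1 ≤ d) (hj : 0 ≤ j) (hjn : j ≤ n) (hε : 0 < ε) : 0 < U d j n ε := by
  have h := integrableOn_integrandU hd hj hjn hε
  rw [integrandU_eq] at h
  rw [U, integrandU_eq]
  exact Real.rpow_pos_of_pos (mul_pos (sphereArea_pos hd)
    (integral_rpow_mul_macdonaldK_sq_div_pos (sub_nonneg.2 hjn) hε h)) _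

theorem V_pos (hd : 1 ≤ d) (hj : 0 ≤ j) (hjn : j ≤ n) (hε : 0 < ε) : 0 < V d j n ε := by
  have h := integrableOn_integrandV hd hj hjn hε
  rw [integrandV_eq] at h
  rw [V, integrandV_eq]
  exact Real.rpow_pos_of_pos (mul_pos (sphereArea_pos hd)
    (integral_rpow_mul_macdonaldK_sq_div_pos (sub_nonneg.2 hjn) hε h)) _

/-- The lower bound for the sharp constant given by the trial function with parameter `ε`. -/
theorem ofReal_Gminus_le_sharpG (hd : 1 ≤ d) (hj : 0 ≤ j) (hjn : j ≤ n) (hε : 0 < ε) {θ : ℝ}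
    (hθ : 0 ≤ θ * n - j) :
    ENNReal.ofReal (Gminus d j n θ ε) ≤ sharpG d j n θ := by
  have hν : 0 ≤ n - j := sub_nonneg.2 hjn
  have hn : 0 ≤ n := hj.trans hjn
  have hq : 0 ≤ n - j / 2 := by linarith
  refine le_iInf₂ fun C hC => ?_
  have hi : ∀ a, n - j ≤ a →
      Integrable fun x : E d => (trialProfile (n - j) (n - j / 2) ε a ‖x‖ : ℂ) :=
    fun a ha => integrable_trialProfile hd hν hq hε ha
  have hm : ∀ a, n - j ≤ a →
      MemLp (fourierT fun x : E d => (trialProfile (n - j) (n - j / 2) ε a ‖x‖ : ℂ)) 2 :=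
    fun a ha => (fourierT_memLp_two_and_eLpNorm_eq (hi a ha)
      (memLp_two_trialProfile hd hν hq hε ha)).1
  have hlap : ∀ s, 0 ≤ s → IsFracLaplacian s
      (fourierT fun x : E d => (trialProfile (n - j) (n - j / 2) ε (n - j) ‖x‖ : ℂ))
      (fourierT fun x : E d => (trialProfile (n - j) (n - j / 2) ε (s + (n - j)) ‖x‖ : ℂ)) :=
    fun s hs => isFracLaplacian_fourierT (hi _ le_rfl) (hi _ (by linarith)) fun k => by
      rw [← rpow_mul_trialProfile (norm_nonneg k) hν hs, Complex.ofReal_mul]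
  -- Since `j + (n - j) = n`, the shifted profile is the one whose transform is `M`.
  have hlapj := hlap j hj
  rw [add_sub_cancel, fourierT_trialProfile_eq_M hd hj hjn hε] at hlapj
  have h := (hC _ _ (hm _ le_rfl) (hm (n + (n - j)) (by linarith)) (hlap n hn)).2 _
    (memLL_M_norm hd hj hjn hε (two_le_rExp hθ)) hlapj
  rw [eLpNorm_fourierT_trialProfile hd hν hq hε le_rfl,
    eLpNorm_fourierT_trialProfile hd hν hq hε (by linarith)] at h
  have hU : U d j n ε = (sphereArea d * ∫ ξ in Ioi (0 : ℝ), ξ ^ (2 * (n - j) + d - 1) *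
      macdonaldK (n - j) ξ ^ 2 / (ξ ^ 2 + ε ^ 2) ^ (2 * (n - j / 2))) ^ ((1 : ℝ) / 2) := by
    rw [U, integrandU_eq]
  have hV : V d j n ε = (sphereArea d * ∫ ξ in Ioi (0 : ℝ), ξ ^ (2 * (n + (n - j)) + d - 1) *
      macdonaldK (n - j) ξ ^ 2 / (ξ ^ 2 + ε ^ 2) ^ (2 * (n - j / 2))) ^ ((1 : ℝ) / 2) := by
    rw [V, integrandV_eq]
  have hU0 := U_pos hd hj hjn hε
  have hV0 := V_pos hd hj hjn hε
  rw [← hU, ← hV, ENNReal.ofReal_rpow_of_pos hU0, ENNReal.ofReal_rpow_of_pos hV0, mul_assoc,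
    ← ENNReal.ofReal_mul (by positivity)] at h
  rw [Gminus, ENNReal.ofReal_div_of_pos (by positivity)]
  exact ENNReal.div_le_of_le_mul ((ofReal_Y_le_eLpNorm hd hj hjn hε hθ).trans h)

end TrialFunctions

end GagliardoNirenberg

open GagliardoNirenberg in
theorem proposition5p14 (d : ℕ) (hd : 1 ≤ d) (j n θ : ℝ) (hjn : GeneralL2 d j n θ) :
    -- the value of the kernel at `0` is its limit
    Tendsto (fun s : ℝ => besselJ ((d : ℝ) / 2 - 1) s / s ^ ((d : ℝ) / 2 - 1)) (𝓝[>] 0)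
      (𝓝 (1 / ((2 : ℝ) ^ ((d : ℝ) / 2 - 1) * Real.Gamma ((d : ℝ) / 2)))) ∧
    (∀ ε : ℝ, 0 < ε →
      -- all the objects entering the lower bound are well defined
      (∀ ρ : ℝ, 0 ≤ ρ → IntegrableOn (integrandM d j n ε ρ) (Ioi 0)) ∧
      ContinuousOn (M d j n ε) (Ici 0) ∧
      IntegrableOn (integrandU d j n ε) (Ioi 0) ∧ 0 < U d j n ε ∧
      IntegrableOn (integrandV d j n ε) (Ioi 0) ∧ 0 < V d j n ε ∧
      (rExp d j n θ ≠ ⊤ → IntegrableOn (integrandY d j n θ ε) (Ioi 0)) ∧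
      (rExp d j n θ = ⊤ → BddAbove ((fun ρ => |M d j n ε ρ|) '' Ici 0)) ∧
      -- the lower bound
      ENNReal.ofReal (Gminus d j n θ ε) ≤ sharpG d j n θ) ∧
    -- its consequence for the supremum over `ε`
    (⨆ ε ∈ Ioi (0 : ℝ), ENNReal.ofReal (Gminus d j n θ ε)) ≤ sharpG d j n θ := by
  obtain ⟨hθ0, hθ1, hn, hj, hθ, -, -⟩ := hjn
  -- `j ≤ θ n ≤ n`, so the order `n - j` of the Macdonald function is nonnegative.
  have hle : j ≤ n := by nlinarith
  have hG : ∀ ε : ℝ, 0 < ε → ENNReal.ofReal (Gminus d j n θ ε) ≤ sharpG d j n θ :=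
    fun ε hε => ofReal_Gminus_le_sharpG hd hj hle hε hθ
  exact ⟨tendsto_besselJ_div_rpow hd, fun ε hε =>
    ⟨fun ρ hρ => integrableOn_integrandM hd hj hle hε hρ, continuousOn_M hd hj hle hε,
      integrableOn_integrandU hd hj hle hε, U_pos hd hj hle hε,
      integrableOn_integrandV hd hj hle hε, V_pos hd hj hle hε,
      integrableOn_integrandY hd hj hle hε hθ, fun _ => bddAbove_abs_M hd hj hle hε, hG ε hε⟩,
    iSup₂_le hG⟩
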